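/- Let $0\le\alpha<1$, $\mu\le\frac{(1-\alpha)^2}{4}$ and $a_1,a_2\in\mathbb R$. Put $$\nu=\frac{2}{2-\alpha}\sqrt{\Big(\frac{1-\alpha}{2}\Big)^2-\mu},\qquad \lambda_n=\Big(\frac{2-\alpha}{2}\Big)^2 j_{\nu,n}^2\quad(n\ge1),$$ where $0<j_{\nu,1}<j_{\nu,2}<\cdots$ are the positive zeros of the Bessel function of the first kind $J_\nu$. Let $\alpha_1,\alpha_2$ be the eigenvalues of $A=\begin{pmatrix}0&a_1\\1&a_2\end{pmatrix}$, ordered as follows: $\alpha_{1}=\frac12\big(a_2-\sqrt{a_2^2+4a_1}\big)$, $\alpha_{2}=\frac12\big(a_2+\sqrt{a_2^2+4a_1}\big)$ if $a_2^2+4a_1\ge0$ (so $\alpha_1=\alpha_2=\frac{a_2}{2}$ in case of equality), and $\alpha_1=\frac12\big(a_2+i\sqrt{-(a_2^2+4a_1)}\big)$, $\alpha_2=\frac12\big(a_2-i\sqrt{-(a_2^2+4a_1)}\big)$ if $a_2^2+4a_1<0$. Assume that $\lambda_n-\lambda_l\ne\alpha_1-\alpha_2$ for all $n,l\ge1$ with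 $n\ne l$. Then there is a sequence $(\Lambda_n)_{n\ge1}$ of complex numbers with $$\{\Lambda_n:n\ge1\}=\{\lambda_n+\alpha_2-\alpha_1:n\ge1\}\cup\{\lambda_n:n\ge1\}$$ such that: 1. $\Lambda_n\ne\Lambda_m$ for all $n\neq m$; 2. $\Re(\Lambda_n)>0$ for all $n\ge1$; 3. there is $\delta>0$ with $|\Im(\Lambda_n)|\le\delta\sqrt{\Re(\Lambda_n)}$ for all $n\ge1$; 4. $|\Lambda_n|\le|\Lambda_{n+1}|$ for all $n\ge1$; 5. there are $\varrho>0$ and an integer $q>0$ such that $|\Lambda_n-\Lambda_m|\ge\varrho|n^2-m^2|$ whenever $n,m\ge1$ and $|n-m|\ge q$, and $\inf_{n\ne m,\,|n-m|<q}|\Lambda_n-\Lambda_m|>0$; 6. there are $p,s>0$ such that, for every $r>0$, the number $\mathcal N(r)=\#\{n\ge1:|\Lambda_n|\le r\}$ is finite and $|p\sqrt r-\mathcal N(r)|\le s$. -/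

import Mathlib

namespace DegenerateSingular

noncomputable section

/-- The Bessel function of the first kind `J_ν`, by its series at the origin
(used for `ν ≥ 0` and `x > 0`). -/
def besselJ (ν x : ℝ) : ℝ :=
  ∑' m : ℕ, (-1 : ℝ) ^ m / ((m.factorial : ℝ) * Real.Gamma (1 + ν + m)) *
    (x / 2) ^ (2 * (m : ℝ) + ν)

/-- `besselZero ν n`, for `n ≥ 1`, is the `n`-th positive zero `j_{ν,n}` of `J_ν`: the first zero
lies after `0`, and each further one is the smallest zero beyond its predecessor.
The value `0` at index `0` only starts the recursion. -/
def besselZero (ν : ℝ) : ℕ → ℝ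
  | 0 => 0
  | n + 1 => sInf {x : ℝ | besselZero ν n < x ∧ besselJ ν x = 0}

/-- The order `ν(α, μ) = 2 / (2 - α) * √(((1 - α) / 2)² - μ)`. -/
def nu (α μ : ℝ) : ℝ :=
  2 / (2 - α) * Real.sqrt (((1 - α) / 2) ^ 2 - μ)

/-- The `n`-th eigenvalue (`n ≥ 1`) `λ_{α,μ,n} = ((2 - α) / 2)² j_{ν(α,μ),n}²` of the operator
`y ↦ -(x^α y')' - μ x^(α-2) y` on `(0, 1)` with Dirichlet boundary conditions. -/
def scalarEigenvalue (α μ : ℝ) (n : ℕ) : ℝ :=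
  ((2 - α) / 2) ^ 2 * besselZero (nu α μ) n ^ 2

/-- The coupling matrix `A`. -/
def couplingMatrix (a₁ a₂ : ℝ) : Matrix (Fin 2) (Fin 2) ℝ :=
  !![0, a₁; 1, a₂]

/-- The eigenvalue `α₁` of the coupling matrix: the smaller one if the eigenvalues are real, the
one with positive imaginary part if they are not real. -/
def alphaOne (a₁ a₂ : ℝ) : ℂ :=
  if 0 ≤ a₂ ^ 2 + 4 * a₁ then
    (1 / 2) * ((a₂ : ℂ) - (Real.sqrt (a₂ ^ 2 + 4 * a₁) : ℂ))
  else
    (1 / 2) * ((a₂ : ℂ) + Complex.I * (Real.sqrt (-(a₂ ^ 2 + 4 * a₁)) : ℂ))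

/-- The other eigenvalue `α₂` of the coupling matrix. -/
def alphaTwo (a₁ a₂ : ℝ) : ℂ :=
  if 0 ≤ a₂ ^ 2 + 4 * a₁ then
    (1 / 2) * ((a₂ : ℂ) + (Real.sqrt (a₂ ^ 2 + 4 * a₁) : ℂ))
  else
    (1 / 2) * ((a₂ : ℂ) - Complex.I * (Real.sqrt (-(a₂ ^ 2 + 4 * a₁)) : ℂ))

/-- `α₁` and `α₂` are the eigenvalues of the coupling matrix, with multiplicity. -/
theorem couplingMatrix_charpoly (a₁ a₂ : ℝ) :
    ((couplingMatrix a₁ a₂).map (fun x : ℝ => (x : ℂ))).charpoly =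
      (Polynomial.X - Polynomial.C (alphaOne a₁ a₂)) *
        (Polynomial.X - Polynomial.C (alphaTwo a₁ a₂)) := by
  have hsum : alphaOne a₁ a₂ + alphaTwo a₁ a₂ = (a₂ : ℂ) := by
    unfold alphaOne alphaTwo
    split_ifs <;> ring
  have hprod : alphaOne a₁ a₂ * alphaTwo a₁ a₂ = -(a₁ : ℂ) := by
    unfold alphaOne alphaTwo
    split_ifs with h
    · have hs : ((Real.sqrt (a₂ ^ 2 + 4 * a₁) : ℝ) : ℂ) ^ 2 = (a₂ : ℂ) ^ 2 + 4 * a₁ := by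
        exact_mod_cast congrArg (fun x : ℝ => (x : ℂ)) (Real.sq_sqrt h)
      linear_combination (-1 / 4 : ℂ) * hs
    · have hs : ((Real.sqrt (-(a₂ ^ 2 + 4 * a₁)) : ℝ) : ℂ) ^ 2 =
          -((a₂ : ℂ) ^ 2 + 4 * a₁) := by
        exact_mod_cast congrArg (fun x : ℝ => (x : ℂ))
          (Real.sq_sqrt (by linarith : (0 : ℝ) ≤ -(a₂ ^ 2 + 4 * a₁)))
      linear_combination (1 / 4 : ℂ) * hs -
        (1 / 4 : ℂ) * ((Real.sqrt (-(a₂ ^ 2 + 4 * a₁)) : ℝ) : ℂ) ^ 2 * Complex.I_sq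
  have hp := congrArg (Polynomial.C : ℂ → Polynomial ℂ) hprod
  have hs := congrArg (Polynomial.C : ℂ → Polynomial ℂ) hsum
  simp only [map_mul, map_add, map_neg] at hp hs
  rw [Matrix.charpoly_fin_two]
  simp only [couplingMatrix, Matrix.trace_fin_two, Matrix.det_fin_two, Matrix.map_apply,
    Matrix.of_apply, Matrix.cons_val', Matrix.cons_val_zero, Matrix.cons_val_one,
    Matrix.cons_val_fin_one, Complex.ofReal_zero, Complex.ofReal_one, zero_add, zero_mul,
    mul_one, zero_sub, map_neg]
  linear_combination Polynomial.X * hs - hp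

/-- The hypotheses of the biorthogonal-family theorem on a sequence `(Λ_n)_{n ≥ 1}` of complex
numbers (the value `Λ 0` plays no role). -/
structure BiorthogonalHypotheses (Λ : ℕ → ℂ) : Prop where
  /-- the terms are pairwise distinct -/
  distinct : ∀ n m : ℕ, 1 ≤ n → 1 ≤ m → n ≠ m → Λ n ≠ Λ m
  /-- the real parts are positive -/
  re_pos : ∀ n : ℕ, 1 ≤ n → 0 < (Λ n).re
  /-- the imaginary part is controlled by the square root of the real part -/
  im_le : ∃ δ : ℝ, 0 < δ ∧ ∀ n : ℕ, 1 ≤ n → |(Λ n).im| ≤ δ * Real.sqrt (Λ n).re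
  /-- the sequence is nondecreasing in modulus -/
  norm_mono : ∀ n : ℕ, 1 ≤ n → ‖Λ n‖ ≤ ‖Λ (n + 1)‖
  /-- the gap condition; the second part says that the infimum of `|Λ_n - Λ_m|` over `n ≠ m` with
  `|n - m| < q` is positive -/
  gap : ∃ (ϱ : ℝ) (q : ℕ), 0 < ϱ ∧ 0 < q ∧
    (∀ n m : ℕ, 1 ≤ n → 1 ≤ m → (q : ℝ) ≤ |(n : ℝ) - m| →
      ϱ * |(n : ℝ) ^ 2 - (m : ℝ) ^ 2| ≤ ‖Λ n - Λ m‖) ∧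
    ∃ c : ℝ, 0 < c ∧ ∀ n m : ℕ, 1 ≤ n → 1 ≤ m → n ≠ m → |(n : ℝ) - m| < q →
      c ≤ ‖Λ n - Λ m‖
  /-- the counting function stays within a bounded distance of `p √r` -/
  counting : ∃ p s : ℝ, 0 < p ∧ 0 < s ∧ ∀ r : ℝ, 0 < r →
    {n : ℕ | 1 ≤ n ∧ ‖Λ n‖ ≤ r}.Finite ∧
    |p * Real.sqrt r - ({n : ℕ | 1 ≤ n ∧ ‖Λ n‖ ≤ r}.ncard : ℝ)| ≤ s

end

end DegenerateSingular

namespace DegenerateSingular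

open Filter Topology Set

/-! Everything reduces to two facts about the zeros: `j_{ν,n} = π n + O(1)`, and the consecutive
gaps are bounded below by some `c > 0`. A multiple of `√x J_ν(x)` solves `w'' = -(1 - (ν² - 1/4)/x²)
w`. On `[a, ∞)` the potential lies between `1 - ν²/a²` and `1 + 1/(4a²)`, so Sturm comparison with
sines puts each gap after `j = j_{ν,n}` between `π/√(1 + 1/(4j²))` and, once `j > ν`, `π/√(1 -
ν²/j²)`. Hence the gaps are `π + O(1/n²)`, and summing gives the first fact
(`exists_abs_besselZero_sub_le`).

It follows that `|λ_n - λ_m| ≥ g |n² - m²|`, and that both `λ_n` and its translate by `d = α₂ - α₁`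
have counting function `√r/β + O(1)`. Distant indices separate the two families because `|λ_n -
λ_m|` outgrows `|d|`; only finitely many pairs remain, and the spectral hypothesis handles those off
the diagonal (`exists_pos_le_norm_add_sub`).

A separated family with counting function `p √r + O(1)` is then sorted by modulus. Inverting the
count gives `p √|Λ_n| = n + O(1)`, from which the quadratic gap condition follows
(`exists_biorthogonalHypotheses`). -/

/-! ### The entire factor of `J_ν` -/

/-- The coefficients of the entire function `t ↦ ∑ (-1)^m / (m! Γ(1 + ν + m)) t^m`. -/
noncomputable def besselCoeff (ν : ℝ) (m : ℕ) : ℝ :=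
  (-1 : ℝ) ^ m / ((m.factorial : ℝ) * Real.Gamma (1 + ν + m))

/-- The entire function `f` with `J_ν(x) = (x / 2)^ν f(x² / 4)`. -/
noncomputable def besselEntire (ν t : ℝ) : ℝ :=
  ∑' m : ℕ, besselCoeff ν m * t ^ m

lemma gamma_one_add_pos {ν : ℝ} (hν : 0 ≤ ν) (m : ℕ) : 0 < Real.Gamma (1 + ν + m) :=
  Real.Gamma_pos_of_pos (by positivity)

lemma besselCoeff_ne_zero {ν : ℝ} (hν : 0 ≤ ν) (m : ℕ) : besselCoeff ν m ≠ 0 := by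
  have := gamma_one_add_pos hν m
  unfold besselCoeff
  positivity

lemma besselCoeff_succ {ν : ℝ} (hν : 0 ≤ ν) (m : ℕ) :
    besselCoeff ν (m + 1) = -(besselCoeff ν m / ((m + 1) * (1 + ν + m))) := by
  have h := gamma_one_add_pos hν m
  have h0 : (1 + ν + m : ℝ) ≠ 0 := by positivity
  have h2 : Real.Gamma (1 + ν + (m + 1 : ℕ)) = (1 + ν + m) * Real.Gamma (1 + ν + m) := by
    rw [← Real.Gamma_add_one h0]; push_cast; ring_nf
  have h3 : ((m : ℝ) + 1) ≠ 0 := by positivity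
  unfold besselCoeff
  rw [h2, Nat.factorial_succ]
  push_cast
  field_simp
  ring

/-- Ratio test: consecutive coefficients have quotient at most `1/(n + 1)` in absolute value. -/
lemma besselCoeff_radius {ν : ℝ} (hν : 0 ≤ ν) :
    (FormalMultilinearSeries.ofScalars ℝ (besselCoeff ν)).radius = ⊤ := by
  apply FormalMultilinearSeries.ofScalars_radius_eq_top_of_tendsto
  · exact Eventually.of_forall fun n => besselCoeff_ne_zero hν n
  · have h1 : Tendsto (fun n : ℕ => 1 / ((n : ℝ) + 1)) atTop (𝓝 0) :=
      tendsto_one_div_add_atTop_nhds_zero_nat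
    refine squeeze_zero (fun n => by positivity) (fun n => ?_) h1
    have hc := besselCoeff_ne_zero hν n
    have hp : (0 : ℝ) < 1 + ν + n := by positivity
    rw [Nat.succ_eq_add_one, besselCoeff_succ hν, norm_neg, norm_div, div_div,
      mul_comm, ← div_div, div_self (norm_ne_zero_iff.2 hc), Real.norm_of_nonneg (by positivity)]
    apply one_div_le_one_div_of_le (by positivity)
    have : (0 : ℝ) ≤ ((n : ℝ) + 1) * (ν + n) := by positivity
    nlinarith

lemma besselCoeff_summable_norm {ν : ℝ} (hν : 0 ≤ ν) {R : ℝ} (hR : 0 ≤ R) :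
    Summable fun m => |besselCoeff ν m| * R ^ m := by
  have h := (FormalMultilinearSeries.ofScalars ℝ (besselCoeff ν)).summable_norm_mul_pow
    (r := ⟨R, hR⟩) (by rw [besselCoeff_radius hν]; exact ENNReal.coe_lt_top)
  simp only [FormalMultilinearSeries.ofScalars_norm] at h
  exact h

lemma besselCoeff_summable {ν : ℝ} (hν : 0 ≤ ν) (t : ℝ) :
    Summable fun m => besselCoeff ν m * t ^ m := by
  apply Summable.of_norm
  simpa using besselCoeff_summable_norm hν (abs_nonneg t)

lemma besselEntire_analyticOnNhd {ν : ℝ} (hν : 0 ≤ ν) :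
    AnalyticOnNhd ℝ (besselEntire ν) univ := by
  have h := (FormalMultilinearSeries.ofScalars ℝ (besselCoeff ν)).hasFPowerSeriesOnBall
    (by rw [besselCoeff_radius hν]; exact ENNReal.zero_lt_top)
  have h2 := h.analyticOnNhd
  rw [besselCoeff_radius hν, Metric.eball_top] at h2
  convert h2 using 1
  ext t
  exact (FormalMultilinearSeries.ofScalars_sum_eq (besselCoeff ν) t).symm

lemma besselEntire_zero_ne {ν : ℝ} (hν : 0 ≤ ν) : besselEntire ν 0 ≠ 0 := by
  unfold besselEntire
  rw [tsum_eq_single 0 (by intro m hm; simp [hm])]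
  simpa using besselCoeff_ne_zero hν 0

/-- The zeros of the entire factor are isolated. -/
lemma besselEntire_eventually_ne {ν : ℝ} (hν : 0 ≤ ν) (t : ℝ) :
    ∀ᶠ s in 𝓝[≠] t, besselEntire ν s ≠ 0 := by
  by_contra h
  have := (besselEntire_analyticOnNhd hν).eqOn_zero_of_preconnected_of_frequently_eq_zero
    isPreconnected_univ (mem_univ t) (by simpa [Filter.not_eventually] using h)
  exact besselEntire_zero_ne hν (this (mem_univ 0))

/-- Termwise differentiation raises the order by one; this is the source of `f_ν' = -f_{ν+1}`. -/
lemma besselCoeff_succ_mul {ν : ℝ} (m : ℕ) :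
    besselCoeff ν (m + 1) * ((m : ℝ) + 1) = -besselCoeff (ν + 1) m := by
  have h3 : ((m : ℝ) + 1) ≠ 0 := by positivity
  have h2 : (1 + ν + ((m + 1 : ℕ) : ℝ)) = 1 + (ν + 1) + m := by push_cast; ring
  unfold besselCoeff
  rw [h2, Nat.factorial_succ]
  push_cast
  field_simp
  ring

lemma besselEntire_hasDerivAt {ν : ℝ} (hν : 0 ≤ ν) (t : ℝ) :
    HasDerivAt (besselEntire ν) (-besselEntire (ν + 1) t) t := by
  have hν' : 0 ≤ ν + 1 := by linarith
  set R := |t| + 1 with hR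
  have hR0 : 0 ≤ R := by positivity
  have key : HasDerivAt (besselEntire ν)
      (∑' m : ℕ, besselCoeff ν m * (m * t ^ (m - 1))) t := by
    unfold besselEntire
    -- On the ball of radius `R` the differentiated series is dominated by its absolute values at
    -- `R`, which after an index shift form the majorant series of order `ν + 1`.
    refine hasDerivAt_tsum_of_isPreconnected (t := Metric.ball (0 : ℝ) R) (y₀ := 0)
      (u := fun m => |besselCoeff ν m| * (m * R ^ (m - 1))) ?_ Metric.isOpen_ball
      (convex_ball _ _).isPreconnected
      (fun n y _ => (hasDerivAt_pow n y).const_mul _) ?_ ?_ ?_ ?_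
    · rw [← summable_nat_add_iff 1]
      refine (besselCoeff_summable_norm hν' hR0).congr fun m => ?_
      rw [← abs_neg (besselCoeff (ν + 1) m), ← besselCoeff_succ_mul, abs_mul,
        abs_of_nonneg (by positivity : (0 : ℝ) ≤ (m : ℝ) + 1)]
      simp [mul_assoc]
    · intro n y hy
      have hy' : |y| ≤ R := by
        have := mem_ball_zero_iff.1 hy
        exact this.le
      rw [norm_mul, norm_mul, norm_pow, Real.norm_eq_abs, Real.norm_eq_abs, Real.norm_eq_abs,
        Nat.abs_cast]
      gcongr
    · exact Metric.mem_ball_self (by positivity)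
    · exact besselCoeff_summable hν 0
    · rw [mem_ball_zero_iff, Real.norm_eq_abs, hR]; linarith
  convert key using 1
  have hs : Summable fun m : ℕ => besselCoeff ν m * (m * t ^ (m - 1)) := by
    rw [← summable_nat_add_iff 1]
    refine (besselCoeff_summable hν' t).neg.congr fun m => ?_
    rw [← neg_mul, ← besselCoeff_succ_mul]
    simp [mul_assoc]
  rw [hs.tsum_eq_zero_add]
  unfold besselEntire
  rw [← tsum_neg]
  simp only [Nat.cast_zero, zero_mul, mul_zero, zero_add]
  refine tsum_congr fun m => ?_
  rw [← neg_mul, ← besselCoeff_succ_mul]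
  simp [mul_assoc]

/-- The three-term recurrence, equivalent to Bessel's differential equation. -/
lemma besselEntire_recurrence {ν : ℝ} (hν : 0 ≤ ν) (t : ℝ) :
    t * besselEntire (ν + 2) t - (1 + ν) * besselEntire (ν + 1) t + besselEntire ν t = 0 := by
  have h0 := besselCoeff_summable hν t
  have h1 := besselCoeff_summable (ν := ν + 1) (by linarith) t
  have h2 := besselCoeff_summable (ν := ν + 2) (by linarith) t
  have hG : ∀ m : ℕ, Real.Gamma (1 + (ν + 1) + m) = (1 + ν + m) * Real.Gamma (1 + ν + m) := by
    intro m
    rw [← Real.Gamma_add_one (by positivity)]; ring_nf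
  -- In the factor `1 + ν + m`, the constant part contributes `(1 + ν) f_{ν+1}` and the part `m`
  -- contributes `-t f_{ν+2}`.
  have e1 : ∀ m : ℕ, besselCoeff ν m = (1 + ν + m) * besselCoeff (ν + 1) m := by
    intro m
    have hp : (1 + ν + m : ℝ) ≠ 0 := by positivity
    have := gamma_one_add_pos hν m
    unfold besselCoeff
    rw [hG]
    field_simp
  have e2 : ∀ m : ℕ, ((m : ℝ) + 1) * besselCoeff (ν + 1) (m + 1) = -besselCoeff (ν + 2) m := by
    intro m
    have := besselCoeff_succ_mul (ν := ν + 1) m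
    rw [mul_comm, this]; ring_nf
  have h3 : Summable fun m : ℕ => (m : ℝ) * besselCoeff (ν + 1) m * t ^ m := by
    refine (h0.sub (h1.mul_left (1 + ν))).congr fun m => ?_
    rw [e1]; ring
  have h4 : ∑' m : ℕ, (m : ℝ) * besselCoeff (ν + 1) m * t ^ m = -(t * besselEntire (ν + 2) t) := by
    rw [h3.tsum_eq_zero_add]
    unfold besselEntire
    rw [← tsum_mul_left, ← tsum_neg]
    simp only [Nat.cast_zero, zero_mul, zero_add]
    refine tsum_congr fun m => ?_
    push_cast
    rw [e2]; ring
  have h5 : besselEntire ν t = (1 + ν) * besselEntire (ν + 1) t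
      + ∑' m : ℕ, (m : ℝ) * besselCoeff (ν + 1) m * t ^ m := by
    unfold besselEntire
    rw [← tsum_mul_left, ← (h1.mul_left _).tsum_add h3]
    refine tsum_congr fun m => ?_
    rw [e1]; ring
  rw [h5, h4]; ring

/-! ### Bessel's equation in normal form -/

lemma besselJ_eq {x : ℝ} (ν : ℝ) (hx : 0 < x) :
    besselJ ν x = (x / 2) ^ ν * besselEntire ν (x ^ 2 / 4) := by
  unfold besselJ besselEntire
  rw [← tsum_mul_left]
  refine tsum_congr fun m => ?_
  rw [Real.rpow_add (by positivity), show (2 * (m : ℝ)) = ((2 * m : ℕ) : ℝ) by push_cast; ring,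
    Real.rpow_natCast, pow_mul, show (x / 2) ^ 2 = x ^ 2 / 4 by ring]
  unfold besselCoeff
  ring

lemma besselJ_eq_zero_iff {ν x : ℝ} (hx : 0 < x) :
    besselJ ν x = 0 ↔ besselEntire ν (x ^ 2 / 4) = 0 := by
  rw [besselJ_eq ν hx, mul_eq_zero, or_iff_right (by positivity)]

/-- `x ↦ x^(ν + 1/2) f(x² / 4)`, a multiple of `√x J_ν(x)`. -/
noncomputable def besselNormal (ν x : ℝ) : ℝ :=
  x ^ (ν + 1 / 2) * besselEntire ν (x ^ 2 / 4)

/-- The derivative of `besselNormal ν` on the positive half-line. -/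
noncomputable def besselNormalDeriv (ν x : ℝ) : ℝ :=
  x ^ (ν - 1 / 2) *
    ((ν + 1 / 2) * besselEntire ν (x ^ 2 / 4) - x ^ 2 / 2 * besselEntire (ν + 1) (x ^ 2 / 4))

lemma besselEntire_comp_hasDerivAt {ν : ℝ} (hν : 0 ≤ ν) (x : ℝ) :
    HasDerivAt (fun x => besselEntire ν (x ^ 2 / 4))
      (-besselEntire (ν + 1) (x ^ 2 / 4) * (x / 2)) x := by
  have h : HasDerivAt (fun x : ℝ => x ^ 2 / 4) (x / 2) x := by
    refine ((hasDerivAt_pow 2 x).div_const 4).congr_deriv ?_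
    norm_num; ring
  exact (besselEntire_hasDerivAt hν (x ^ 2 / 4)).comp x h

lemma besselNormal_hasDerivAt {ν x : ℝ} (hν : 0 ≤ ν) (hx : 0 < x) :
    HasDerivAt (besselNormal ν) (besselNormalDeriv ν x) x := by
  have h := (Real.hasDerivAt_rpow_const (p := ν + 1 / 2) (Or.inl hx.ne')).mul
    (besselEntire_comp_hasDerivAt hν x)
  refine h.congr_deriv ?_
  unfold besselNormalDeriv
  have e : x ^ (ν + 1 / 2) = x ^ (ν - 1 / 2) * x := by
    rw [← Real.rpow_add_one hx.ne']; ring_nf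
  rw [e, show ν + 1 / 2 - 1 = ν - 1 / 2 by ring]
  ring

/-- Bessel's equation in Liouville normal form. -/
lemma besselNormalDeriv_hasDerivAt {ν x : ℝ} (hν : 0 ≤ ν) (hx : 0 < x) :
    HasDerivAt (besselNormalDeriv ν) (-(1 - (ν ^ 2 - 1 / 4) / x ^ 2) * besselNormal ν x) x := by
  have h2 : HasDerivAt (fun x : ℝ => x ^ 2 / 2) x x := by
    refine ((hasDerivAt_pow 2 x).div_const 2).congr_deriv ?_
    norm_num
  have h := (Real.hasDerivAt_rpow_const (p := ν - 1 / 2) (Or.inl hx.ne')).mul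
    (((besselEntire_comp_hasDerivAt hν x).const_mul (ν + 1 / 2)).sub
      (h2.mul (besselEntire_comp_hasDerivAt (ν := ν + 1) (by linarith) x)))
  refine h.congr_deriv ?_
  have hr := besselEntire_recurrence hν (x ^ 2 / 4)
  unfold besselNormal
  have e : x ^ (ν - 1 / 2) = x ^ (ν - 1 / 2 - 1) * x := by
    rw [← Real.rpow_add_one hx.ne']; ring_nf
  have e' : x ^ (ν + 1 / 2) = x ^ (ν - 1 / 2 - 1) * x * x := by
    rw [← Real.rpow_add_one hx.ne', ← Real.rpow_add_one hx.ne']; ring_nf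
  rw [e', e, show ν + 1 + 1 = ν + 2 by ring]
  simp only [Pi.sub_apply, Pi.mul_apply]
  field_simp
  linear_combination (16 * x ^ 2) * hr

/-! ### Sturm comparison with sines -/

lemma forall_pos_or_forall_neg {u : ℝ → ℝ} {s : Set ℝ} (hs : IsPreconnected s)
    (hu : ContinuousOn u s) (h0 : ∀ x ∈ s, u x ≠ 0) :
    (∀ x ∈ s, 0 < u x) ∨ (∀ x ∈ s, u x < 0) := by
  by_contra! h
  obtain ⟨⟨x, hx, hux⟩, ⟨y, hy, huy⟩⟩ := h
  obtain ⟨z, hz, hz0⟩ := hs.intermediate_value hx hy hu ⟨hux, huy⟩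
  exact h0 z hz hz0

lemma hasDerivAt_sin_mul_sub (k a x : ℝ) :
    HasDerivAt (fun x => Real.sin (k * (x - a))) (k * Real.cos (k * (x - a))) x := by
  have h : HasDerivAt (fun x => k * (x - a)) k x := by
    simpa using ((hasDerivAt_id x).sub_const a).const_mul k
  simpa [mul_comm] using h.sin

lemma hasDerivAt_cos_mul_sub (k a x : ℝ) :
    HasDerivAt (fun x => Real.cos (k * (x - a))) (-(k * Real.sin (k * (x - a)))) x := by
  have h : HasDerivAt (fun x => k * (x - a)) k x := by
    simpa using ((hasDerivAt_id x).sub_const a).const_mul k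
  simpa [mul_comm] using h.cos

/-- The Wronskian of a solution of `u'' = -q u` with `sin (k (x - a))`. -/
lemma hasDerivAt_wronskian_sin {u u' : ℝ → ℝ} {q k a x : ℝ} (hu : HasDerivAt u (u' x) x)
    (hu' : HasDerivAt u' (-q * u x) x) :
    HasDerivAt
      (fun x => u' x * Real.sin (k * (x - a)) - u x * (k * Real.cos (k * (x - a))))
      ((k ^ 2 - q) * u x * Real.sin (k * (x - a))) x := by
  refine ((hu'.mul (hasDerivAt_sin_mul_sub k a x)).sub
    (hu.mul ((hasDerivAt_cos_mul_sub k a x).const_mul k))).congr_deriv ?_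
  ring

lemma sin_mul_sub_pos {k a b x : ℝ} (hk : 0 < k) (hb : b - a ≤ Real.pi / k) (hx : x ∈ Ioo a b) :
    0 < Real.sin (k * (x - a)) := by
  apply Real.sin_pos_of_pos_of_lt_pi (mul_pos hk (by linarith [hx.1]))
  have : x - a < Real.pi / k := by linarith [hx.2]
  rw [lt_div_iff₀ hk] at this
  linarith

/-- For positive `u` the Wronskian with `sin (k (x - a))` is nonincreasing. Its values at the
endpoints are `-k u(a)` and `k u(b)`, where `b = a + π/k`, so `u(b) ≤ -u(a) ≤ 0`, a contradiction.
-/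
lemma not_forall_pos_of_sq_le {u u' q : ℝ → ℝ} {a k : ℝ} (hk : 0 < k)
    (hu : ∀ x ∈ Icc a (a + Real.pi / k), HasDerivAt u (u' x) x)
    (hu' : ∀ x ∈ Icc a (a + Real.pi / k), HasDerivAt u' (-q x * u x) x)
    (hq : ∀ x ∈ Icc a (a + Real.pi / k), k ^ 2 ≤ q x) :
    ¬ ∀ x ∈ Ioc a (a + Real.pi / k), 0 < u x := by
  intro hpos
  set b := a + Real.pi / k with hb
  have hab : a < b := by have := Real.pi_pos; have : 0 < Real.pi / k := by positivity
                         linarith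
  have hW := fun x (hx : x ∈ Icc a b) => hasDerivAt_wronskian_sin (k := k) (a := a) (hu x hx)
    (hu' x hx)
  -- The point `a` may itself be a zero; continuity still gives the sign needed.
  have hua : 0 ≤ u a := by
    have hcl : a ∈ closure (Ioc a b) := by
      rw [closure_Ioc hab.ne]; exact left_mem_Icc.2 hab.le
    refine ContinuousWithinAt.closure_le hcl continuousWithinAt_const
      ((hu a (left_mem_Icc.2 hab.le)).continuousAt.continuousWithinAt) fun x hx => (hpos x hx).le
  have hanti : AntitoneOn
      (fun x => u' x * Real.sin (k * (x - a)) - u x * (k * Real.cos (k * (x - a)))) (Icc a b) := by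
    refine antitoneOn_of_hasDerivWithinAt_nonpos (convex_Icc a b)
      (fun x hx => (hW x hx).continuousAt.continuousWithinAt)
      (fun x hx => (hW x (interior_subset hx)).hasDerivWithinAt) fun x hx => ?_
    rw [interior_Icc] at hx
    have h1 := sin_mul_sub_pos hk (by rw [hb]; linarith) hx
    have h2 := hpos x ⟨hx.1, hx.2.le⟩
    have h3 := hq x ⟨hx.1.le, hx.2.le⟩
    have := mul_nonneg h2.le h1.le
    nlinarith
  have h := hanti (left_mem_Icc.2 hab.le) (right_mem_Icc.2 hab.le) hab.le
  have hkb : k * (b - a) = Real.pi := by rw [hb]; field_simp; ring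
  simp only [hkb, sub_self, mul_zero, Real.sin_zero, Real.cos_zero, Real.sin_pi, Real.cos_pi] at h
  have := hpos b (right_mem_Ioc.2 hab)
  nlinarith

/-- Sturm comparison from below: a solution of `u'' = -q u` with `k² ≤ q` has a zero in every
half-open interval of length `π / k`. -/
lemma exists_zero_of_sq_le {u u' q : ℝ → ℝ} {a k : ℝ} (hk : 0 < k)
    (hu : ∀ x ∈ Icc a (a + Real.pi / k), HasDerivAt u (u' x) x)
    (hu' : ∀ x ∈ Icc a (a + Real.pi / k), HasDerivAt u' (-q x * u x) x)
    (hq : ∀ x ∈ Icc a (a + Real.pi / k), k ^ 2 ≤ q x) :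
    ∃ x ∈ Ioc a (a + Real.pi / k), u x = 0 := by
  by_contra! h
  rcases forall_pos_or_forall_neg isPreconnected_Ioc
    (fun x hx => (hu x (Ioc_subset_Icc_self hx)).continuousAt.continuousWithinAt) h with h | h
  · exact not_forall_pos_of_sq_le hk hu hu' hq h
  · refine not_forall_pos_of_sq_le (u := fun x => -u x) (u' := fun x => -u' x) hk
      (fun x hx => (hu x hx).neg) (fun x hx => (hu' x hx).neg.congr_deriv (by ring)) hq
      fun x hx => neg_pos.2 (h x hx)

/-- If `b - a < π/k`, the sine is positive on `(a, b]`, including at `b`. The Wronskian starts at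
`0` and is nondecreasing, so `u / sin` is nondecreasing on `(a, b]`; but it is positive inside and
vanishes at `b`. -/
lemma pi_div_le_of_pos {u u' q : ℝ → ℝ} {a b k : ℝ} (hk : 0 < k) (hab : a < b)
    (hu : ∀ x ∈ Icc a b, HasDerivAt u (u' x) x)
    (hu' : ∀ x ∈ Icc a b, HasDerivAt u' (-q x * u x) x)
    (hq : ∀ x ∈ Icc a b, q x ≤ k ^ 2) (ha : u a = 0) (hb : u b = 0)
    (hpos : ∀ x ∈ Ioo a b, 0 < u x) : Real.pi / k ≤ b - a := by
  by_contra! hlt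
  have hW := fun x (hx : x ∈ Icc a b) => hasDerivAt_wronskian_sin (k := k) (a := a) (hu x hx)
    (hu' x hx)
  have hsin : ∀ x ∈ Ioc a b, 0 < Real.sin (k * (x - a)) := fun x hx =>
    sin_mul_sub_pos (b := a + Real.pi / k) hk (by linarith) ⟨hx.1, by linarith [hx.2]⟩
  have hmono : MonotoneOn
      (fun x => u' x * Real.sin (k * (x - a)) - u x * (k * Real.cos (k * (x - a)))) (Icc a b) := by
    refine monotoneOn_of_hasDerivWithinAt_nonneg (convex_Icc a b)
      (fun x hx => (hW x hx).continuousAt.continuousWithinAt)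
      (fun x hx => (hW x (interior_subset hx)).hasDerivWithinAt) fun x hx => ?_
    rw [interior_Icc] at hx
    have h1 := hsin x ⟨hx.1, hx.2.le⟩
    have h2 := hpos x hx
    have h3 := hq x ⟨hx.1.le, hx.2.le⟩
    exact mul_nonneg (mul_nonneg (by linarith) h2.le) h1.le
  have hWnn : ∀ x ∈ Icc a b,
      0 ≤ u' x * Real.sin (k * (x - a)) - u x * (k * Real.cos (k * (x - a))) := by
    intro x hx
    have h := hmono (left_mem_Icc.2 hab.le) hx hx.1
    simpa [ha] using h
  have hquot := fun x (hx : x ∈ Ioc a b) => (hu x (Ioc_subset_Icc_self hx)).div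
    (hasDerivAt_sin_mul_sub k a x) (hsin x hx).ne'
  have hmono' : MonotoneOn (u / fun x => Real.sin (k * (x - a))) (Ioc a b) := by
    refine monotoneOn_of_hasDerivWithinAt_nonneg (convex_Ioc a b)
      (fun x hx => (hquot x hx).continuousAt.continuousWithinAt)
      (fun x hx => (hquot x (interior_subset hx)).hasDerivWithinAt) fun x hx => ?_
    exact div_nonneg (hWnn x (Ioc_subset_Icc_self (interior_subset hx))) (sq_nonneg _)
  have hm : (a + b) / 2 ∈ Ioo a b := ⟨by linarith, by linarith⟩
  have h := hmono' (Ioo_subset_Ioc_self hm) (right_mem_Ioc.2 hab) hm.2.le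
  simp only [Pi.div_apply, hb, zero_div] at h
  exact absurd h (not_le.2 (div_pos (hpos _ hm) (hsin _ (Ioo_subset_Ioc_self hm))))

/-- Sturm comparison from above: consecutive zeros of a solution of `u'' = -q u` with `q ≤ k²`
are at least `π / k` apart. -/
lemma pi_div_le_of_consecutive_zeros {u u' q : ℝ → ℝ} {a b k : ℝ} (hk : 0 < k) (hab : a < b)
    (hu : ∀ x ∈ Icc a b, HasDerivAt u (u' x) x)
    (hu' : ∀ x ∈ Icc a b, HasDerivAt u' (-q x * u x) x)
    (hq : ∀ x ∈ Icc a b, q x ≤ k ^ 2) (ha : u a = 0) (hb : u b = 0)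
    (hne : ∀ x ∈ Ioo a b, u x ≠ 0) : Real.pi / k ≤ b - a := by
  rcases forall_pos_or_forall_neg isPreconnected_Ioo
    (fun x hx => (hu x (Ioo_subset_Icc_self hx)).continuousAt.continuousWithinAt) hne with h | h
  · exact pi_div_le_of_pos hk hab hu hu' hq ha hb h
  · exact pi_div_le_of_pos (u := fun x => -u x) (u' := fun x => -u' x) hk hab
      (fun x hx => (hu x hx).neg) (fun x hx => (hu' x hx).neg.congr_deriv (by ring)) hq
      (by simp [ha]) (by simp [hb]) fun x hx => neg_pos.2 (h x hx)

/-! ### Existence, isolation and spacing of the zeros -/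

lemma besselNormal_eq_zero_iff {ν x : ℝ} (hx : 0 < x) :
    besselNormal ν x = 0 ↔ besselJ ν x = 0 := by
  rw [besselJ_eq_zero_iff hx, besselNormal, mul_eq_zero, or_iff_right (by positivity)]

/-- Lower bound for the potential in the normal form of Bessel's equation. -/
lemma one_sub_le_besselPotential {ν a x : ℝ} (ha : 0 < a) (hx : a ≤ x) :
    1 - ν ^ 2 / a ^ 2 ≤ 1 - (ν ^ 2 - 1 / 4) / x ^ 2 := by
  have hx0 : 0 < x := ha.trans_le hx
  have h1 : ν ^ 2 / x ^ 2 ≤ ν ^ 2 / a ^ 2 := by gcongr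
  have h2 : (ν ^ 2 - 1 / 4) / x ^ 2 ≤ ν ^ 2 / x ^ 2 := by gcongr; linarith
  linarith

/-- Upper bound for the potential in the normal form of Bessel's equation. -/
lemma besselPotential_le_one_add {ν a x : ℝ} (ha : 0 < a) (hx : a ≤ x) :
    1 - (ν ^ 2 - 1 / 4) / x ^ 2 ≤ 1 + 1 / 4 / a ^ 2 := by
  have hx0 : 0 < x := ha.trans_le hx
  have h1 : (1 / 4) / x ^ 2 ≤ (1 / 4) / a ^ 2 := by gcongr
  have h2 : -(ν ^ 2 - 1 / 4) / x ^ 2 ≤ (1 / 4) / x ^ 2 := by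
    gcongr; nlinarith [sq_nonneg ν]
  rw [neg_div] at h2
  linarith

lemma exists_besselJ_zero_mem_Ioc {ν a : ℝ} (hν : 0 ≤ ν) (ha : 0 < a)
    (h : 0 < 1 - ν ^ 2 / a ^ 2) :
    ∃ x ∈ Ioc a (a + Real.pi / Real.sqrt (1 - ν ^ 2 / a ^ 2)), besselJ ν x = 0 := by
  obtain ⟨x, hx, hx0⟩ := exists_zero_of_sq_le (u := besselNormal ν) (u' := besselNormalDeriv ν)
    (q := fun x => 1 - (ν ^ 2 - 1 / 4) / x ^ 2) (a := a) (Real.sqrt_pos.2 h)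
    (fun x hx => besselNormal_hasDerivAt hν (ha.trans_le hx.1))
    (fun x hx => besselNormalDeriv_hasDerivAt hν (ha.trans_le hx.1))
    (fun x hx => by
      rw [Real.sq_sqrt h.le]
      exact one_sub_le_besselPotential ha hx.1)
  exact ⟨x, hx, (besselNormal_eq_zero_iff (ha.trans hx.1)).1 hx0⟩

lemma exists_besselJ_zero_gt {ν : ℝ} (hν : 0 ≤ ν) (a : ℝ) : ∃ x, a < x ∧ besselJ ν x = 0 := by
  -- Beyond `ν + 1` the comparison frequency `1 - ν²/b²` is positive.
  set b := max a (ν + 1) with hb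
  have hb1 : ν + 1 ≤ b := le_max_right _ _
  have hb0 : 0 < b := by linarith
  have h : 0 < 1 - ν ^ 2 / b ^ 2 := by
    rw [sub_pos, div_lt_one (by positivity)]
    nlinarith
  obtain ⟨x, hx, hx0⟩ := exists_besselJ_zero_mem_Ioc hν hb0 h
  exact ⟨x, (le_max_left _ _).trans_lt hx.1, hx0⟩

/-- Isolation comes from the entire factor, whose value at `0` is nonzero; this covers `a = 0`,
where the recursion for the zeros starts. -/
lemma exists_besselJ_ne_zero_right {ν a : ℝ} (hν : 0 ≤ ν) (ha : 0 ≤ a) :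
    ∃ b, a < b ∧ ∀ x ∈ Ioo a b, besselJ ν x ≠ 0 := by
  have ht : Tendsto (fun x : ℝ => x ^ 2 / 4) (𝓝[>] a) (𝓝[≠] (a ^ 2 / 4)) := by
    refine tendsto_nhdsWithin_iff.2 ⟨?_, ?_⟩
    · exact (Continuous.tendsto (by fun_prop) a).mono_left nhdsWithin_le_nhds
    · filter_upwards [self_mem_nhdsWithin] with x hx
      have hx : a < x := hx
      have : a ^ 2 / 4 < x ^ 2 / 4 := by nlinarith
      exact this.ne'
  have h := ht.eventually (besselEntire_eventually_ne hν (a ^ 2 / 4))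
  obtain ⟨b, hb, hb'⟩ := mem_nhdsGT_iff_exists_Ioo_subset.1 h
  exact ⟨b, hb, fun x hx => fun h0 => hb' hx ((besselJ_eq_zero_iff (ha.trans_lt hx.1)).1 h0)⟩

/-- The zeros of `J_ν` beyond a nonnegative point have a least element. -/
lemma isLeast_besselJ_zero {ν a : ℝ} (hν : 0 ≤ ν) (ha : 0 ≤ a) :
    IsLeast {x : ℝ | a < x ∧ besselJ ν x = 0} (sInf {x : ℝ | a < x ∧ besselJ ν x = 0}) := by
  obtain ⟨b, hb, hb'⟩ := exists_besselJ_ne_zero_right hν ha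
  -- The zero-free interval after `a` turns the open condition `a < x` into the closed one `b ≤ x`,
  -- so the set is closed and its infimum is attained.
  have hS : {x : ℝ | a < x ∧ besselJ ν x = 0} =
      Ici b ∩ {x : ℝ | besselEntire ν (x ^ 2 / 4) = 0} := by
    ext x
    constructor
    · rintro ⟨h1, h2⟩
      exact ⟨not_lt.1 fun h => hb' x ⟨h1, h⟩ h2, (besselJ_eq_zero_iff (ha.trans_lt h1)).1 h2⟩
    · rintro ⟨h1, h2⟩
      have h1 : b ≤ x := h1
      exact ⟨hb.trans_le h1, (besselJ_eq_zero_iff (by linarith)).2 h2⟩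
  have hc : IsClosed {x : ℝ | a < x ∧ besselJ ν x = 0} := by
    rw [hS]
    refine isClosed_Ici.inter (isClosed_eq ?_ continuous_const)
    exact continuous_iff_continuousAt.2 fun x => (besselEntire_comp_hasDerivAt hν x).continuousAt
  exact hc.isLeast_csInf (exists_besselJ_zero_gt hν a) ⟨a, fun x hx => hx.1.le⟩

/-- The infimum in the recursion is attained at every stage. Nonnegativity is carried along because
the least-zero lemma needs a nonnegative base point. -/
lemma besselZero_nonneg_and_isLeast {ν : ℝ} (hν : 0 ≤ ν) (n : ℕ) :
    0 ≤ besselZero ν n ∧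
      IsLeast {x : ℝ | besselZero ν n < x ∧ besselJ ν x = 0} (besselZero ν (n + 1)) := by
  induction n with
  | zero => exact ⟨le_rfl, isLeast_besselJ_zero hν le_rfl⟩
  | succ n ih =>
    have h : 0 ≤ besselZero ν (n + 1) := ih.1.trans ih.2.1.1.le
    exact ⟨h, isLeast_besselJ_zero hν h⟩

lemma besselZero_strictMono {ν : ℝ} (hν : 0 ≤ ν) : StrictMono (besselZero ν) :=
  strictMono_nat_of_lt_succ fun n => (besselZero_nonneg_and_isLeast hν n).2.1.1

lemma besselZero_pos {ν : ℝ} (hν : 0 ≤ ν) {n : ℕ} (hn : 1 ≤ n) : 0 < besselZero ν n :=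
  besselZero_strictMono hν (show 0 < n from hn)

lemma besselJ_besselZero {ν : ℝ} (hν : 0 ≤ ν) {n : ℕ} (hn : 1 ≤ n) :
    besselJ ν (besselZero ν n) = 0 := by
  obtain ⟨m, rfl⟩ := Nat.exists_eq_add_of_le' hn
  exact (besselZero_nonneg_and_isLeast hν m).2.1.2

lemma besselZero_succ_le {ν x : ℝ} (hν : 0 ≤ ν) {n : ℕ} (hx : besselZero ν n < x)
    (h0 : besselJ ν x = 0) : besselZero ν (n + 1) ≤ x :=
  (besselZero_nonneg_and_isLeast hν n).2.2 ⟨hx, h0⟩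

lemma le_besselZero_succ_sub {ν : ℝ} (hν : 0 ≤ ν) {n : ℕ} (hn : 1 ≤ n) :
    Real.pi / Real.sqrt (1 + 1 / 4 / besselZero ν n ^ 2) ≤
      besselZero ν (n + 1) - besselZero ν n := by
  have ha := besselZero_pos hν hn
  have hlt := besselZero_strictMono hν (Nat.lt_succ_self n)
  have hK : 0 < 1 + 1 / 4 / besselZero ν n ^ 2 := by positivity
  refine pi_div_le_of_consecutive_zeros (u := besselNormal ν) (u' := besselNormalDeriv ν)
    (q := fun x => 1 - (ν ^ 2 - 1 / 4) / x ^ 2) (Real.sqrt_pos.2 hK) hlt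
    (fun x hx => besselNormal_hasDerivAt hν (ha.trans_le hx.1))
    (fun x hx => besselNormalDeriv_hasDerivAt hν (ha.trans_le hx.1))
    (fun x hx => ?_) ?_ ?_ fun x hx h0 => ?_
  · rw [Real.sq_sqrt hK.le]
    exact besselPotential_le_one_add ha hx.1
  · exact (besselNormal_eq_zero_iff ha).2 (besselJ_besselZero hν hn)
  · exact (besselNormal_eq_zero_iff (ha.trans hlt)).2 (besselJ_besselZero hν (by omega))
  · have := besselZero_succ_le hν hx.1 ((besselNormal_eq_zero_iff (ha.trans hx.1)).1 h0)
    exact absurd hx.2 (not_lt.2 this)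

lemma besselZero_succ_sub_le {ν : ℝ} (hν : 0 ≤ ν) {n : ℕ} (hn : 1 ≤ n)
    (h : 0 < 1 - ν ^ 2 / besselZero ν n ^ 2) :
    besselZero ν (n + 1) - besselZero ν n ≤
      Real.pi / Real.sqrt (1 - ν ^ 2 / besselZero ν n ^ 2) := by
  obtain ⟨x, hx, hx0⟩ := exists_besselJ_zero_mem_Ioc hν (besselZero_pos hν hn) h
  linarith [besselZero_succ_le hν hx.1 hx0, hx.2]

/-! ### Asymptotics of the zeros -/

/-- The gaps between consecutive positive zeros of `J_ν` are bounded away from zero. -/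
lemma exists_pos_le_besselZero_gap {ν : ℝ} (hν : 0 ≤ ν) :
    ∃ c : ℝ, 0 < c ∧ ∀ n : ℕ, c ≤ besselZero ν (n + 1) - besselZero ν n := by
  have h1 := besselZero_pos hν (le_refl 1)
  set c := Real.pi / Real.sqrt (1 + 1 / 4 / besselZero ν 1 ^ 2) with hc
  -- The Sturm lower bound increases with the zero, so `n = 1` is its worst case. At index `0` the
  -- gap is `j_{ν,1}` itself.
  refine ⟨min c (besselZero ν 1), lt_min (by have := Real.pi_pos; positivity) h1, fun n => ?_⟩
  rcases Nat.eq_zero_or_pos n with rfl | hn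
  · refine (min_le_right _ _).trans ?_
    simp [besselZero]
  · refine (min_le_left _ _).trans ((le_besselZero_succ_sub hν hn).trans' ?_)
    have : besselZero ν 1 ≤ besselZero ν n := (besselZero_strictMono hν).monotone hn
    have := Real.pi_pos
    rw [hc]
    gcongr

lemma mul_le_besselZero {ν c : ℝ} (h : ∀ n : ℕ, c ≤ besselZero ν (n + 1) - besselZero ν n)
    (n : ℕ) : c * n ≤ besselZero ν n := by
  induction n with
  | zero => simp [besselZero]
  | succ n ih => push_cast; linarith [h n]

lemma one_sub_le_one_div_sqrt {y : ℝ} (hy : 0 ≤ y) : 1 - y ≤ 1 / Real.sqrt (1 + y) := by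
  rw [le_div_iff₀ (Real.sqrt_pos.2 (by linarith))]
  have h1 : Real.sqrt (1 + y) ≤ 1 + y := Real.sqrt_le_self_iff.2 (Or.inr (by linarith))
  have h2 := Real.sqrt_nonneg (1 + y)
  rcases le_or_gt y 1 with h | h <;> nlinarith

lemma one_div_sqrt_le_one_add {y : ℝ} (hy : 0 ≤ y) (hy' : y ≤ 1 / 2) :
    1 / Real.sqrt (1 - y) ≤ 1 + 2 * y := by
  have h0 : 0 < 1 - y := by linarith
  rw [div_le_iff₀ (Real.sqrt_pos.2 h0)]
  have h1 : 1 - y ≤ Real.sqrt (1 - y) := Real.le_sqrt_of_sq_le (by nlinarith)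
  nlinarith

/-- The hypothesis puts `y = ν²/j²` in the range `y ≤ 1/2`, where `1/√(1 - y) ≤ 1 + 2y`; both Sturm
bounds are then `π + O(1/j²)`. -/
lemma abs_besselZero_gap_sub_pi_le {ν : ℝ} (hν : 0 ≤ ν) {n : ℕ} (hn : 1 ≤ n)
    (h : 2 * ν ^ 2 ≤ besselZero ν n ^ 2) :
    |besselZero ν (n + 1) - besselZero ν n - Real.pi| ≤
      Real.pi * (1 / 4 + 2 * ν ^ 2) / besselZero ν n ^ 2 := by
  have hj := besselZero_pos hν hn
  have hπ := Real.pi_pos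
  have hy : ν ^ 2 / besselZero ν n ^ 2 ≤ 1 / 2 := by
    rw [div_le_iff₀ (by positivity)]; linarith
  have hlow := le_besselZero_succ_sub hν hn
  have hup := besselZero_succ_sub_le hν hn (by linarith)
  have h1 := mul_le_mul_of_nonneg_left
    (one_sub_le_one_div_sqrt (y := 1 / 4 / besselZero ν n ^ 2) (by positivity)) hπ.le
  have h2 := mul_le_mul_of_nonneg_left
    (one_div_sqrt_le_one_add (y := ν ^ 2 / besselZero ν n ^ 2) (by positivity) hy) hπ.le
  rw [mul_one_div] at h1 h2
  have h3 : Real.pi * (1 / 4 + 2 * ν ^ 2) / besselZero ν n ^ 2 =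
      Real.pi * (1 / 4 / besselZero ν n ^ 2) + Real.pi * (2 * (ν ^ 2 / besselZero ν n ^ 2)) := by
    ring
  have h4 : 0 ≤ Real.pi * (1 / 4 / besselZero ν n ^ 2) := by positivity
  have h5 : 0 ≤ Real.pi * (2 * (ν ^ 2 / besselZero ν n ^ 2)) := by positivity
  rw [h3, abs_le]
  constructor <;> linarith

/-- `j_{ν,n} = π n + O(1)`. -/
lemma exists_abs_besselZero_sub_le {ν : ℝ} (hν : 0 ≤ ν) :
    ∃ B : ℝ, ∀ n : ℕ, |besselZero ν n - Real.pi * n| ≤ B := by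
  obtain ⟨c, hc, hgap⟩ := exists_pos_le_besselZero_gap hν
  have hlin := mul_le_besselZero hgap
  set D := Real.pi * (1 / 4 + 2 * ν ^ 2) with hD
  have hD0 : 0 ≤ D := by have := Real.pi_pos; positivity
  have hsum : Summable fun n : ℕ => D / c ^ 2 * (1 / (n : ℝ) ^ 2) :=
    (Real.summable_one_div_nat_pow.2 one_lt_two).mul_left _
  have hev : ∀ᶠ n : ℕ in atTop, 2 * ν ^ 2 ≤ (c * n) ^ 2 := by
    have : Tendsto (fun n : ℕ => (c * (n : ℝ)) ^ 2) atTop atTop :=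
      (tendsto_pow_atTop two_ne_zero).comp (tendsto_natCast_atTop_atTop.const_mul_atTop hc)
    exact this.eventually_ge_atTop _
  -- The increments of `j_{ν,n} - π n` are `O(1/n²)` because `j_{ν,n} ≥ c n`. Hence this sequence is
  -- Cauchy, and in particular bounded.
  have hdist : Summable fun n : ℕ => dist (besselZero ν n - Real.pi * n)
      (besselZero ν n.succ - Real.pi * n.succ) := by
    refine Summable.of_norm_bounded_eventually_nat hsum ?_
    filter_upwards [hev, eventually_ge_atTop 1] with n h1 hn
    have hn0 : (0 : ℝ) < n := by exact_mod_cast hn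
    have hcn : 0 < c * n := by positivity
    have hsq : (c * n) ^ 2 ≤ besselZero ν n ^ 2 := by have := hlin n; gcongr
    have h := abs_besselZero_gap_sub_pi_le hν hn (h1.trans hsq)
    rw [Real.norm_of_nonneg dist_nonneg, dist_comm, Real.dist_eq]
    calc |besselZero ν n.succ - Real.pi * n.succ - (besselZero ν n - Real.pi * n)|
        = |besselZero ν (n + 1) - besselZero ν n - Real.pi| := by
          congr 1; push_cast; ring
      _ ≤ D / besselZero ν n ^ 2 := h
      _ ≤ D / (c * n) ^ 2 := by gcongr
      _ = D / c ^ 2 * (1 / (n : ℝ) ^ 2) := by field_simp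
  have hcs := cauchySeq_of_summable_dist hdist
  obtain ⟨B, hB⟩ := hcs.isBounded_range.exists_norm_le
  exact ⟨B, fun n => hB _ (mem_range_self n)⟩

/-! ### Sorting by modulus and inverting the counting function -/

/-- An infinite countable family of real numbers with finite sublevel sets can be enumerated in
nondecreasing order. -/
lemma exists_equiv_nat_monotone {ι : Type*} [Infinite ι] [Countable ι] (N : ι → ℝ)
    (hN : ∀ r : ℝ, {i | N i ≤ r}.Finite) : ∃ e : ℕ ≃ ι, Monotone fun n => N (e n) := by
  classical
  obtain ⟨k, hk⟩ := exists_injective_nat ι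
  -- Ties in `N` are broken by an injection into `ℕ`. The resulting linear order has finite initial
  -- segments and no maximum, so it is order isomorphic to `ℕ`.
  let F : ι → ℝ ×ₗ ℕ := fun i => toLex (N i, k i)
  have hF : Function.Injective F := fun i j h => hk (congrArg (fun p => (ofLex p).2) h)
  let : LinearOrder ι := LinearOrder.lift' F hF
  have hle : ∀ {i j : ι}, i ≤ j → N i ≤ N j := by
    intro i j h
    have h : F i ≤ F j := h
    rcases Prod.Lex.toLex_le_toLex.1 h with h | h
    · exact h.le
    · exact h.1.le
  have hIic : ∀ i : ι, (Iic i).Finite := fun i => (hN (N i)).subset fun j hj => hle hj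
  let : LocallyFiniteOrder ι :=
    LocallyFiniteOrder.ofFiniteIcc fun a b => (hIic b).subset Icc_subset_Iic_self
  obtain ⟨b, hb⟩ : ∃ b : ι, ∀ i, b ≤ i := by
    obtain ⟨i₀⟩ := (inferInstance : Nonempty ι)
    obtain ⟨b, hb, hmin⟩ := (hIic i₀).exists_minimal ⟨i₀, le_refl i₀⟩
    refine ⟨b, fun i => ?_⟩
    rcases le_total b i with h | h
    · exact h
    · exact hmin (h.trans hb) h
  let : OrderBot ι := { bot := b, bot_le := hb }
  have : NoMaxOrder ι := ⟨fun a => by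
    by_contra! h
    exact Set.infinite_univ ((hIic a).subset fun i _ => h i)⟩
  let : SuccOrder ι := LinearLocallyFiniteOrder.succOrder ι
  let : PredOrder ι := LinearLocallyFiniteOrder.predOrder ι
  let φ : ι ≃o ℕ := orderIsoNatOfLinearSuccPredArch
  exact ⟨φ.symm.toEquiv, fun m n h => hle (φ.symm.monotone h)⟩

/-- A nondecreasing sequence of moduli whose counting function is `p √r + O(1)` satisfies
`p √|Λ_n| = n + O(1)`. -/
lemma abs_mul_sqrt_sub_le_of_counting {a : ℕ → ℝ} {p s : ℝ} (hp : 0 < p) (hs : 0 < s)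
    (ha : ∀ n, 1 ≤ n → 0 < a n) (hmono : ∀ m n, 1 ≤ m → m ≤ n → a m ≤ a n)
    (hfin : ∀ r : ℝ, 0 < r → {n : ℕ | 1 ≤ n ∧ a n ≤ r}.Finite)
    (hcount : ∀ r : ℝ, 0 < r →
      |p * Real.sqrt r - ({n : ℕ | 1 ≤ n ∧ a n ≤ r}.ncard : ℝ)| ≤ s) {n : ℕ} (hn : 1 ≤ n) :
    |p * Real.sqrt (a n) - n| ≤ s := by
  rw [abs_le]
  constructor
  · have hsub : Icc 1 n ⊆ {m : ℕ | 1 ≤ m ∧ a m ≤ a n} := fun m hm =>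
      ⟨hm.1, hmono m n hm.1 hm.2⟩
    have h1 : n ≤ {m : ℕ | 1 ≤ m ∧ a m ≤ a n}.ncard := by
      have := Set.ncard_le_ncard hsub (hfin _ (ha n hn))
      rwa [← Finset.coe_Icc, Set.ncard_coe_finset, Nat.card_Icc, Nat.add_sub_cancel] at this
    have h1 : (n : ℝ) ≤ ({m : ℕ | 1 ≤ m ∧ a m ≤ a n}.ncard : ℝ) := by exact_mod_cast h1
    linarith [(abs_le.1 (hcount _ (ha n hn))).1]
  · by_contra! h
    -- At level `x² < a n` only indices below `n` are counted, at most `n - 1` of them, whereas the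
    -- counting estimate demands at least `p x - s = n`.
    set x := (n + s) / p with hx
    have hx0 : 0 < x := by positivity
    have hxlt : x < Real.sqrt (a n) := by rw [hx, div_lt_iff₀ hp]; linarith
    have hr : x ^ 2 < a n := (Real.lt_sqrt hx0.le).1 hxlt
    have hsub : {m : ℕ | 1 ≤ m ∧ a m ≤ x ^ 2} ⊆ Ico 1 n := fun m hm =>
      ⟨hm.1, not_le.1 fun hnm => by linarith [hmono n m hn hnm, hm.2]⟩
    have h1 : {m : ℕ | 1 ≤ m ∧ a m ≤ x ^ 2}.ncard ≤ n - 1 := by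
      have := Set.ncard_le_ncard hsub (Set.finite_Ico 1 n)
      rwa [← Finset.coe_Ico, Set.ncard_coe_finset, Nat.card_Ico] at this
    have h2 : ({m : ℕ | 1 ≤ m ∧ a m ≤ x ^ 2}.ncard : ℝ) + 1 ≤ n := by
      exact_mod_cast (by omega : {m : ℕ | 1 ≤ m ∧ a m ≤ x ^ 2}.ncard + 1 ≤ n)
    have h3 := (abs_le.1 (hcount (x ^ 2) (by positivity))).2
    rw [Real.sqrt_sq hx0.le, hx, mul_div_cancel₀ _ hp.ne'] at h3
    linarith

/-- Quadratic growth of the gaps of a sequence with `p √a_n = n + O(1)`. -/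
lemma sq_sub_sq_le_of_abs_mul_sqrt_sub_le {a : ℕ → ℝ} {p s : ℝ} (hp : 0 < p)
    (ha : ∀ n, 1 ≤ n → 0 < a n) (h : ∀ n, 1 ≤ n → |p * Real.sqrt (a n) - n| ≤ s)
    {m n : ℕ} (hm : 1 ≤ m) (hn : 1 ≤ n) (hmn : 4 * s ≤ (n : ℝ) - m) :
    1 / (8 * p ^ 2) * ((n : ℝ) ^ 2 - (m : ℝ) ^ 2) ≤ a n - a m := by
  have h1 := abs_le.1 (h n hn)
  have h2 := abs_le.1 (h m hm)
  have hs : 0 ≤ s := (abs_nonneg _).trans (h n hn)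
  have hm0 : (0 : ℝ) ≤ m := m.cast_nonneg
  set x := Real.sqrt (a n) with hx
  set y := Real.sqrt (a m) with hy
  have hx2 : x ^ 2 = a n := Real.sq_sqrt (ha n hn).le
  have hy2 : y ^ 2 = a m := Real.sq_sqrt (ha m hm).le
  have hy0 : 0 ≤ y := Real.sqrt_nonneg _
  -- The errors total at most `2s ≤ (n - m)/2`, and `s ≤ (n - m)/4` handles the sum. Multiplying the
  -- two bounds yields the constant `1/8`.
  have h3 : ((n : ℝ) - m) / 2 ≤ p * x - p * y := by linarith [h1.1, h2.2]
  have h4 : ((n : ℝ) + m) / 4 ≤ p * x + p * y := by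
    have := mul_nonneg hp.le hy0
    linarith [h1.1]
  have h5 := mul_le_mul h3 h4 (by linarith) (by linarith)
  rw [← hx2, ← hy2, div_mul_eq_mul_div, one_mul, div_le_iff₀ (by positivity)]
  nlinarith

/-- A uniformly separated family in the right half-plane, with the right imaginary parts and
counting function, can be enumerated so as to satisfy the hypotheses of the biorthogonal-family
theorem. -/
lemma exists_biorthogonalHypotheses {ι : Type*} [Infinite ι] [Countable ι] (z : ι → ℂ)
    {δ c p s : ℝ} (hδ : 0 < δ) (hc : 0 < c) (hp : 0 < p) (hs : 0 < s)
    (hre : ∀ i, 0 < (z i).re) (him : ∀ i, |(z i).im| ≤ δ * Real.sqrt (z i).re)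
    (hsep : ∀ i j, i ≠ j → c ≤ ‖z i - z j‖)
    (hcount : ∀ r : ℝ, 0 < r → {i | ‖z i‖ ≤ r}.Finite ∧
      |p * Real.sqrt r - ({i | ‖z i‖ ≤ r}.ncard : ℝ)| ≤ s) :
    ∃ Λ : ℕ → ℂ, {w : ℂ | ∃ n : ℕ, 1 ≤ n ∧ w = Λ n} = range z ∧ BiorthogonalHypotheses Λ := by
  have hfin : ∀ r : ℝ, {i | ‖z i‖ ≤ r}.Finite := fun r =>
    (hcount (max r 1) (by positivity)).1.subset fun i (hi : ‖z i‖ ≤ r) =>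
      hi.trans (le_max_left r 1)
  obtain ⟨e, he⟩ := exists_equiv_nat_monotone (fun i => ‖z i‖) hfin
  -- The enumeration `e` starts at `0` and `Λ` at `1`; the value `Λ 0` is irrelevant.
  set Λ : ℕ → ℂ := fun n => z (e (n - 1)) with hΛ
  have hidx : ∀ {n m : ℕ}, 1 ≤ n → 1 ≤ m → n ≠ m → e (n - 1) ≠ e (m - 1) := by
    intro n m hn hm hnm h
    have := e.injective h
    omega
  have hset : ∀ r : ℝ, {n : ℕ | 1 ≤ n ∧ ‖Λ n‖ ≤ r} =
      (fun i => e.symm i + 1) '' {i | ‖z i‖ ≤ r} := by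
    intro r
    ext n
    constructor
    · rintro ⟨hn, h⟩
      exact ⟨e (n - 1), h, by simp; omega⟩
    · rintro ⟨i, hi, rfl⟩
      exact ⟨by simp, by simpa [hΛ] using hi⟩
  have hcountΛ : ∀ r : ℝ, 0 < r → {n : ℕ | 1 ≤ n ∧ ‖Λ n‖ ≤ r}.Finite ∧
      |p * Real.sqrt r - ({n : ℕ | 1 ≤ n ∧ ‖Λ n‖ ≤ r}.ncard : ℝ)| ≤ s := by
    intro r hr
    have hinj : Function.Injective fun i => e.symm i + 1 :=
      (add_left_injective 1).comp e.symm.injective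
    rw [hset r, Set.ncard_image_of_injective _ hinj]
    exact ⟨(hcount r hr).1.image _, (hcount r hr).2⟩
  have hpos : ∀ n, 1 ≤ n → 0 < ‖Λ n‖ := fun n _ =>
    norm_pos_iff.2 fun h => (hre (e (n - 1))).ne' (by rw [show z (e (n - 1)) = 0 from h]; rfl)
  have hasymp := fun n (hn : 1 ≤ n) => abs_mul_sqrt_sub_le_of_counting hp hs hpos
    (fun m n hm hmn => he (Nat.sub_le_sub_right hmn 1)) (fun r hr => (hcountΛ r hr).1)
    (fun r hr => (hcountΛ r hr).2) hn
  refine ⟨Λ, ?_, ⟨?_, fun n _ => hre _, ⟨δ, hδ, fun n _ => him _⟩, fun n _ => he (by omega), ?_,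
    ⟨p, s, hp, hs, hcountΛ⟩⟩⟩
  · ext w
    constructor
    · rintro ⟨n, -, rfl⟩
      exact ⟨_, rfl⟩
    · rintro ⟨i, rfl⟩
      exact ⟨e.symm i + 1, by simp, by simp [hΛ]⟩
  · intro n m hn hm hnm h
    have := hsep _ _ (hidx hn hm hnm)
    rw [show z (e (n - 1)) = z (e (m - 1)) from h, sub_self, norm_zero] at this
    linarith
  -- Indices at least `4s` apart are separated already by their moduli; for closer ones the uniform
  -- separation `c` suffices.
  · refine ⟨1 / (8 * p ^ 2), ⌈4 * s⌉₊, by positivity, Nat.ceil_pos.2 (by positivity), ?_,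
      c, hc, fun n m hn hm hnm _ => hsep _ _ (hidx hn hm hnm)⟩
    intro n m hn hm hnm
    have hq : 4 * s ≤ |(n : ℝ) - m| := (Nat.le_ceil _).trans hnm
    have key : ∀ n m : ℕ, 1 ≤ n → 1 ≤ m → 4 * s ≤ (n : ℝ) - m →
        1 / (8 * p ^ 2) * |(n : ℝ) ^ 2 - (m : ℝ) ^ 2| ≤ ‖Λ n - Λ m‖ := by
      intro n m hn hm h
      have hm0 : (0 : ℝ) ≤ m := m.cast_nonneg
      rw [abs_of_nonneg (by nlinarith)]
      exact (sq_sub_sq_le_of_abs_mul_sqrt_sub_le hp hpos hasymp hm hn h).trans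
        (norm_sub_norm_le _ _)
    rcases le_abs.1 hq with h | h
    · exact key n m hn hm h
    · rw [abs_sub_comm, norm_sub_rev]
      exact key m n hm hn (by linarith)

/-! ### A sequence together with a translate -/

/-- Counting function of a sequence with `t_n = β (n + 1) + O(1)`. -/
lemma abs_div_sub_ncard_le {t : ℕ → ℝ} {β B : ℝ} (hβ : 0 < β)
    (ht : ∀ n : ℕ, |t n - β * (n + 1)| ≤ B) {x : ℝ} (hx : 0 ≤ x) :
    {n | t n ≤ x}.Finite ∧ |x / β - ({n | t n ≤ x}.ncard : ℝ)| ≤ B / β + 1 := by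
  have hB : 0 ≤ B := (abs_nonneg _).trans (ht 0)
  have hup : {n | t n ≤ x} ⊆ (Finset.range ⌊(x + B) / β⌋₊ : Set ℕ) := by
    intro n hn
    have hn : t n ≤ x := hn
    rw [Finset.coe_range, mem_Iio, Nat.lt_iff_add_one_le]
    apply Nat.le_floor
    rw [le_div_iff₀ hβ]
    push_cast
    linarith [(abs_le.1 (ht n)).1]
  have hlow : (Finset.range ⌊(x - B) / β⌋₊ : Set ℕ) ⊆ {n | t n ≤ x} := by
    intro n hn
    -- Here `x - B` may be negative; the floor criterion still applies because `n + 1 ≠ 0`.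
    rw [Finset.coe_range, mem_Iio, Nat.lt_iff_add_one_le, Nat.le_floor_iff' (by omega),
      le_div_iff₀ hβ] at hn
    push_cast at hn
    have := (abs_le.1 (ht n)).2
    show t n ≤ x
    linarith
  have hfin : {n | t n ≤ x}.Finite := (Finset.finite_toSet _).subset hup
  refine ⟨hfin, ?_⟩
  have h1 := Set.ncard_le_ncard hup (Finset.finite_toSet _)
  have h2 := Set.ncard_le_ncard hlow hfin
  rw [Set.ncard_coe_finset, Finset.card_range] at h1 h2
  have h1' : ({n | t n ≤ x}.ncard : ℝ) ≤ (x + B) / β :=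
    (Nat.cast_le.2 h1).trans (Nat.floor_le (by positivity))
  have h2' : (x - B) / β < ({n | t n ≤ x}.ncard : ℝ) + 1 :=
    (Nat.lt_floor_add_one _).trans_le (by gcongr)
  rw [add_div] at h1'
  rw [sub_div] at h2'
  rw [abs_le]
  constructor <;> linarith

/-- Counting function of a sequence with `√|z_n| = β (n + 1) + O(1)`. -/
lemma abs_sqrt_div_sub_ncard_le {z : ℕ → ℂ} {β B : ℝ} (hβ : 0 < β)
    (hz : ∀ n : ℕ, |Real.sqrt ‖z n‖ - β * (n + 1)| ≤ B) {r : ℝ} (hr : 0 < r) :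
    {n | ‖z n‖ ≤ r}.Finite ∧
      |Real.sqrt r / β - ({n | ‖z n‖ ≤ r}.ncard : ℝ)| ≤ B / β + 1 := by
  have h := abs_div_sub_ncard_le hβ hz (Real.sqrt_nonneg r)
  simpa only [Real.sqrt_le_sqrt_iff hr.le] using h

lemma abs_sqrt_sub_sqrt_le {a b : ℝ} (ha : 0 ≤ a) (hb : 0 ≤ b) :
    |Real.sqrt a - Real.sqrt b| ≤ Real.sqrt |a - b| := by
  apply Real.le_sqrt_of_sq_le
  rw [sq_abs]
  have h1 := Real.sq_sqrt ha
  have h2 := Real.sq_sqrt hb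
  have h3 := Real.sqrt_nonneg a
  have h4 := Real.sqrt_nonneg b
  rcases le_total a b with h | h
  · have := Real.sqrt_le_sqrt h
    rw [abs_of_nonpos (by linarith)]; nlinarith
  · have := Real.sqrt_le_sqrt h
    rw [abs_of_nonneg (by linarith)]; nlinarith

/-- Translation by `d` moves the modulus by at most `‖d‖`, hence its square root by at most `√‖d‖`;
the leading term of the count is unchanged. -/
lemma abs_sqrt_norm_add_sub_le {l : ℕ → ℝ} {β B : ℝ} (hl : ∀ n, 0 ≤ l n)
    (hB : ∀ n : ℕ, |Real.sqrt (l n) - β * (n + 1)| ≤ B) (d : ℂ) (n : ℕ) :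
    |Real.sqrt ‖(l n : ℂ) + d‖ - β * (n + 1)| ≤ B + Real.sqrt ‖d‖ := by
  have h1 := abs_sqrt_sub_sqrt_le (norm_nonneg ((l n : ℂ) + d)) (hl n)
  have h2 : |‖(l n : ℂ) + d‖ - l n| ≤ ‖d‖ := by
    have := abs_norm_sub_norm_le ((l n : ℂ) + d) (l n)
    rwa [add_sub_cancel_left, Complex.norm_of_nonneg (hl n)] at this
  have h3 := h1.trans (Real.sqrt_le_sqrt h2)
  have h4 := abs_add_le (Real.sqrt ‖(l n : ℂ) + d‖ - Real.sqrt (l n))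
    (Real.sqrt (l n) - β * (n + 1))
  rw [sub_add_sub_cancel] at h4
  linarith [hB n]

lemma add_le_abs_sq_sub_sq {n m : ℕ} (h : n ≠ m) :
    (n : ℝ) + m + 2 ≤ |((n : ℝ) + 1) ^ 2 - ((m : ℝ) + 1) ^ 2| := by
  have key : ∀ n m : ℕ, m < n →
      (n : ℝ) + m + 2 ≤ ((n : ℝ) + 1) ^ 2 - ((m : ℝ) + 1) ^ 2 := by
    intro n m h
    have h1 : (m : ℝ) + 1 ≤ n := by exact_mod_cast h
    have h0 : (0 : ℝ) ≤ m := m.cast_nonneg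
    nlinarith
  rcases lt_or_gt_of_ne h with h | h
  · rw [abs_sub_comm]
    linarith [le_abs_self (((m : ℝ) + 1) ^ 2 - ((n : ℝ) + 1) ^ 2), key m n h]
  · linarith [le_abs_self (((n : ℝ) + 1) ^ 2 - ((m : ℝ) + 1) ^ 2), key n m h]

/-- Uniform separation between a sequence with quadratically growing gaps and a translate of it
that it does not meet. -/
lemma exists_pos_le_norm_add_sub {l : ℕ → ℝ} {g : ℝ} (hg : 0 < g)
    (hl : ∀ n m : ℕ, g * |((n : ℝ) + 1) ^ 2 - ((m : ℝ) + 1) ^ 2| ≤ |l n - l m|) {d : ℂ}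
    (hd : d ≠ 0) (hne : ∀ n m : ℕ, n ≠ m → (l n : ℂ) + d - l m ≠ 0) :
    ∃ c : ℝ, 0 < c ∧ ∀ n m : ℕ, c ≤ ‖(l n : ℂ) + d - l m‖ := by
  -- Outside the square of indices below `M`, off-diagonal pairs have `|l n - l m| ≥ g M ≥ ‖d‖ + 1`,
  -- hence distance at least `1`. The square is finite, and on the diagonal the distance is `‖d‖`.
  obtain ⟨M, hM⟩ := exists_nat_ge ((‖d‖ + 1) / g)
  rw [div_le_iff₀ hg] at hM
  have hsmall : ∀ v : ℝ, 0 < v → ∀ᶠ c in 𝓝[>] (0 : ℝ), c ≤ v := fun v hv =>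
    (eventually_le_nhds hv).filter_mono nhdsWithin_le_nhds
  have hT : ∀ᶠ c in 𝓝[>] (0 : ℝ), ∀ q ∈ Finset.range M ×ˢ Finset.range M,
      c ≤ ‖(l q.1 : ℂ) + d - l q.2‖ := by
    refine (Filter.eventually_all_finset _).2 fun q _ => hsmall _ (norm_pos_iff.2 ?_)
    by_cases hq : q.1 = q.2
    · simpa [hq] using hd
    · exact hne _ _ hq
  obtain ⟨c, ⟨⟨hcT, hc1⟩, hcd⟩, hc0⟩ := (((hT.and (hsmall 1 one_pos)).and
    (hsmall ‖d‖ (norm_pos_iff.2 hd))).and self_mem_nhdsWithin).exists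
  refine ⟨c, hc0, fun n m => ?_⟩
  by_cases hnm : n = m
  · simpa [hnm] using hcd
  by_cases hmem : (n, m) ∈ Finset.range M ×ˢ Finset.range M
  · exact hcT _ hmem
  · have h1 : (M : ℝ) ≤ n + m + 2 := by
      have : M ≤ n + m + 2 := by
        by_contra! h
        exact hmem (by simp only [Finset.mem_product, Finset.mem_range]; omega)
      exact_mod_cast this
    have h2 := mul_le_mul_of_nonneg_left (add_le_abs_sq_sub_sq hnm) hg.le
    have h3 : |l n - l m| - ‖d‖ ≤ ‖(l n : ℂ) + d - l m‖ := by
      have := norm_sub_le_norm_add ((l n : ℂ) - l m) d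
      rw [← Complex.ofReal_sub, Complex.norm_real, Real.norm_eq_abs, Complex.ofReal_sub] at this
      rwa [add_sub_right_comm]
    nlinarith [hl n m]

/-- The union of a positive sequence `l` with `√l_n = β (n + 1) + O(1)` and quadratically growing
gaps, and of a translate of `l` that does not meet it, can be enumerated so as to satisfy the
hypotheses of the biorthogonal-family theorem. -/
lemma exists_biorthogonalHypotheses_union {l : ℕ → ℝ} {g β B : ℝ} (hg : 0 < g) (hβ : 0 < β)
    (hgl : ∀ n, g ≤ l n)
    (hl : ∀ n m : ℕ, g * |((n : ℝ) + 1) ^ 2 - ((m : ℝ) + 1) ^ 2| ≤ |l n - l m|)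
    (hB : ∀ n : ℕ, |Real.sqrt (l n) - β * (n + 1)| ≤ B) {d : ℂ} (hd : 0 ≤ d.re)
    (hne : ∀ n m : ℕ, n ≠ m → (l n : ℂ) + d - l m ≠ 0) :
    ∃ Λ : ℕ → ℂ, {w : ℂ | ∃ n : ℕ, 1 ≤ n ∧ w = Λ n} =
      range (fun n => (l n : ℂ) + d) ∪ range (fun n => (l n : ℂ)) ∧
      BiorthogonalHypotheses Λ := by
  have hl0 : ∀ n, 0 ≤ l n := fun n => hg.le.trans (hgl n)
  have hB0 : 0 ≤ B := (abs_nonneg _).trans (hB 0)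
  have hsep : ∀ n m : ℕ, n ≠ m → g ≤ |l n - l m| := fun n m h => by
    have h1 := mul_le_mul_of_nonneg_left (add_le_abs_sq_sub_sq h) hg.le
    have h2 : (0 : ℝ) ≤ (n : ℝ) + m := by positivity
    nlinarith [hl n m]
  have hsepC : ∀ n m : ℕ, n ≠ m → g ≤ ‖(l n : ℂ) - l m‖ := fun n m h => by
    rw [← Complex.ofReal_sub, Complex.norm_real]
    exact hsep n m h
  have hcount : ∀ r : ℝ, 0 < r → {n | ‖(l n : ℂ)‖ ≤ r}.Finite ∧
      |Real.sqrt r / β - ({n | ‖(l n : ℂ)‖ ≤ r}.ncard : ℝ)| ≤ B / β + 1 := fun r hr =>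
    abs_sqrt_div_sub_ncard_le (z := fun n => (l n : ℂ)) hβ
      (fun n => by rw [Complex.norm_of_nonneg (hl0 n)]; exact hB n) hr
  by_cases hd0 : d = 0
  -- The two families coincide, so each value must be listed once and the counting constant is `1/β`
  -- instead of `2/β`.
  · obtain ⟨Λ, hΛ, hyp⟩ := exists_biorthogonalHypotheses (fun n => (l n : ℂ)) (δ := 1)
      (p := 1 / β) (s := B / β + 1) one_pos hg (by positivity) (by positivity)
      (fun n => by simpa using hg.trans_le (hgl n)) (fun n => by simp) hsepC
      (fun r hr => by rw [one_div_mul_eq_div]; exact hcount r hr)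
    exact ⟨Λ, by rw [hΛ]; simp [hd0], hyp⟩
  · obtain ⟨c, hc, hmix⟩ := exists_pos_le_norm_add_sub hg hl hd0 hne
    set z : ℕ ⊕ ℕ → ℂ := Sum.elim (fun n => (l n : ℂ) + d) (fun n => (l n : ℂ)) with hz
    set B' := B + Real.sqrt ‖d‖ with hB'
    have hcount' : ∀ r : ℝ, 0 < r → {n | ‖(l n : ℂ) + d‖ ≤ r}.Finite ∧
        |Real.sqrt r / β - ({n | ‖(l n : ℂ) + d‖ ≤ r}.ncard : ℝ)| ≤ B' / β + 1 := fun r hr =>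
      abs_sqrt_div_sub_ncard_le (z := fun n => (l n : ℂ) + d) hβ
        (fun n => abs_sqrt_norm_add_sub_le hl0 hB d n) hr
    have hre : ∀ i, g ≤ (z i).re := by
      rintro (n | n)
      · simpa [hz] using add_le_add (hgl n) hd
      · simpa [hz] using hgl n
    have him : ∀ i, |(z i).im| ≤ |d.im| := by
      rintro (n | n) <;> simp [hz]
    have hset : ∀ r : ℝ, {i | ‖z i‖ ≤ r} =
        Sum.inl '' {n | ‖(l n : ℂ) + d‖ ≤ r} ∪ Sum.inr '' {n | ‖(l n : ℂ)‖ ≤ r} := by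
      intro r
      ext (n | n) <;> simp [hz]
    -- All real parts are at least `g`, so `δ ≥ |d.im|/√g` suffices; adding `1` keeps `δ` positive
    -- when `d` is real. The two counts add up, whence `2/β`.
    obtain ⟨Λ, hΛ, hyp⟩ := exists_biorthogonalHypotheses z (δ := |d.im| / Real.sqrt g + 1)
      (c := min g c) (p := 2 / β) (s := (B' / β + 1) + (B / β + 1)) (by positivity)
      (lt_min hg hc) (by positivity) (by positivity) (fun i => hg.trans_le (hre i))
      (fun i => by
        have hsg := Real.sqrt_pos.2 hg
        have h1 := Real.sqrt_le_sqrt (hre i)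
        have h2 : |d.im| ≤ |d.im| / Real.sqrt g * Real.sqrt (z i).re := by
          rw [div_mul_eq_mul_div, le_div_iff₀ hsg]
          gcongr
        linarith [him i, Real.sqrt_nonneg (z i).re])
      (by
        rintro (n | n) (m | m) hnm
        · refine (min_le_left _ _).trans ?_
          simpa [hz] using hsepC n m fun h => hnm (by rw [h])
        · exact (min_le_right _ _).trans (hmix n m)
        · refine (min_le_right _ _).trans ?_
          rw [norm_sub_rev]
          exact hmix m n
        · refine (min_le_left _ _).trans ?_
          simpa [hz] using hsepC n m fun h => hnm (by rw [h]))
      (fun r hr => by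
        obtain ⟨hf1, hc1⟩ := hcount r hr
        obtain ⟨hf2, hc2⟩ := hcount' r hr
        have hf1' := hf1.image (Sum.inr : ℕ → ℕ ⊕ ℕ)
        have hf2' := hf2.image (Sum.inl : ℕ → ℕ ⊕ ℕ)
        rw [hset r]
        refine ⟨hf2'.union hf1', ?_⟩
        rw [Set.ncard_union_eq Set.disjoint_image_inl_image_inr hf2' hf1',
          Set.ncard_image_of_injective _ Sum.inl_injective,
          Set.ncard_image_of_injective _ Sum.inr_injective]
        push_cast
        rw [show 2 / β * Real.sqrt r = Real.sqrt r / β + Real.sqrt r / β by ring,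
          add_sub_add_comm]
        exact (abs_add_le _ _).trans (add_le_add hc2 hc1))
    exact ⟨Λ, by rw [hΛ, hz, Set.Sum.elim_range], hyp⟩

/-! ### Application to the eigenvalues -/

/-- Quadratic growth of the gaps between squares of zeros of `J_ν`. -/
lemma mul_abs_sq_sub_sq_le_besselZero {ν c : ℝ} (hc : 0 < c)
    (h : ∀ n : ℕ, c ≤ besselZero ν (n + 1) - besselZero ν n) (n m : ℕ) :
    c ^ 2 * |(n : ℝ) ^ 2 - (m : ℝ) ^ 2| ≤ |besselZero ν n ^ 2 - besselZero ν m ^ 2| := by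
  -- Summing the gaps bounds `j_n - j_m` below by `c (n - m)`; the product with `j_n + j_m ≥ c (n +
  -- m)` is the claim.
  have hmono : Monotone fun n : ℕ => besselZero ν n - c * n :=
    monotone_nat_of_le_succ fun n => by push_cast; linarith [h n]
  have hlin := mul_le_besselZero h
  have key : ∀ n m : ℕ, m ≤ n →
      c ^ 2 * |(n : ℝ) ^ 2 - (m : ℝ) ^ 2| ≤ |besselZero ν n ^ 2 - besselZero ν m ^ 2| := by
    intro n m hmn
    have h1 := hmono hmn
    simp only at h1
    have hmn' : (m : ℝ) ≤ n := by exact_mod_cast hmn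
    have h0 : (0 : ℝ) ≤ m := m.cast_nonneg
    have h2 : c * ((n : ℝ) - m) ≤ besselZero ν n - besselZero ν m := by linarith
    have h3 : c * ((n : ℝ) + m) ≤ besselZero ν n + besselZero ν m := by linarith [hlin n, hlin m]
    have h4 := mul_le_mul h2 h3 (by positivity)
      ((mul_nonneg hc.le (sub_nonneg.2 hmn')).trans h2)
    rw [abs_of_nonneg (by nlinarith : (0 : ℝ) ≤ (n : ℝ) ^ 2 - (m : ℝ) ^ 2)]
    refine le_trans ?_ (le_abs_self _)
    nlinarith
  rcases le_total m n with hmn | hmn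
  · exact key n m hmn
  · rw [abs_sub_comm, abs_sub_comm (besselZero ν n ^ 2)]
    exact key m n hmn

lemma nu_nonneg {α : ℝ} (hα : α < 1) (μ : ℝ) : 0 ≤ nu α μ :=
  mul_nonneg (div_nonneg zero_le_two (by linarith)) (Real.sqrt_nonneg _)

/-- The ordering of the eigenvalues matters here: the difference is a nonnegative real or purely
imaginary, so the translate stays in the right half-plane. -/
lemma alphaTwo_sub_alphaOne_re_nonneg (a₁ a₂ : ℝ) :
    0 ≤ (alphaTwo a₁ a₂ - alphaOne a₁ a₂).re := by
  unfold alphaTwo alphaOne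
  split_ifs with h
  · rw [show (1 / 2 : ℂ) * ((a₂ : ℂ) + (Real.sqrt (a₂ ^ 2 + 4 * a₁) : ℂ)) -
      (1 / 2) * ((a₂ : ℂ) - (Real.sqrt (a₂ ^ 2 + 4 * a₁) : ℂ)) =
      (Real.sqrt (a₂ ^ 2 + 4 * a₁) : ℂ) by ring, Complex.ofReal_re]
    exact Real.sqrt_nonneg _
  · rw [show (1 / 2 : ℂ) * ((a₂ : ℂ) - Complex.I * (Real.sqrt (-(a₂ ^ 2 + 4 * a₁)) : ℂ)) -
      (1 / 2) * ((a₂ : ℂ) + Complex.I * (Real.sqrt (-(a₂ ^ 2 + 4 * a₁)) : ℂ)) =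
      -(Complex.I * (Real.sqrt (-(a₂ ^ 2 + 4 * a₁)) : ℂ)) by ring]
    simp

lemma setOf_exists_one_le_eq_range {X : Type*} (f : ℕ → X) :
    {z : X | ∃ n : ℕ, 1 ≤ n ∧ z = f n} = range fun n => f (n + 1) := by
  ext z
  constructor
  · rintro ⟨n, hn, rfl⟩
    exact ⟨n - 1, by simp only; rw [Nat.sub_add_cancel hn]⟩
  · rintro ⟨n, rfl⟩
    exact ⟨n + 1, by omega, rfl⟩

end DegenerateSingular

theorem proposition3p5 (α μ a₁ a₂ : ℝ) (hα₀ : 0 ≤ α) (hα₁ : α < 1)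
    (hμ : μ ≤ (1 - α) ^ 2 / 4)
    (hspec : ∀ n l : ℕ, 1 ≤ n → 1 ≤ l → n ≠ l →
      (DegenerateSingular.scalarEigenvalue α μ n : ℂ) -
          (DegenerateSingular.scalarEigenvalue α μ l : ℂ) ≠
        DegenerateSingular.alphaOne a₁ a₂ - DegenerateSingular.alphaTwo a₁ a₂) :
    ∃ Λ : ℕ → ℂ,
      {z : ℂ | ∃ n : ℕ, 1 ≤ n ∧ z = Λ n} =
        {z : ℂ | ∃ n : ℕ, 1 ≤ n ∧ z = (DegenerateSingular.scalarEigenvalue α μ n : ℂ) +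
            DegenerateSingular.alphaTwo a₁ a₂ - DegenerateSingular.alphaOne a₁ a₂} ∪
        {z : ℂ | ∃ n : ℕ, 1 ≤ n ∧ z = (DegenerateSingular.scalarEigenvalue α μ n : ℂ)} ∧
      DegenerateSingular.BiorthogonalHypotheses Λ := by
  have hν := DegenerateSingular.nu_nonneg hα₁ μ
  obtain ⟨c, hc, hgap⟩ := DegenerateSingular.exists_pos_le_besselZero_gap hν
  obtain ⟨B, hB⟩ := DegenerateSingular.exists_abs_besselZero_sub_le hν
  have hlin := DegenerateSingular.mul_le_besselZero hgap
  set κ := (2 - α) / 2 with hκ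
  have hκ0 : 0 < κ := by rw [hκ]; linarith
  have hscalar : ∀ n, DegenerateSingular.scalarEigenvalue α μ n =
      κ ^ 2 * DegenerateSingular.besselZero (DegenerateSingular.nu α μ) n ^ 2 := fun n => rfl
  -- Since `√λ_n = κ j_{ν,n}`, the bounds for the zeros scale by `κ` and those for squared gaps by
  -- `κ²`. The sequence is reindexed from `0`.
  obtain ⟨Λ, hΛ, hyp⟩ := DegenerateSingular.exists_biorthogonalHypotheses_union
    (l := fun n => DegenerateSingular.scalarEigenvalue α μ (n + 1))
    (g := κ ^ 2 * c ^ 2) (β := κ * Real.pi) (B := κ * B)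
    (d := DegenerateSingular.alphaTwo a₁ a₂ - DegenerateSingular.alphaOne a₁ a₂)
    (by positivity) (mul_pos hκ0 Real.pi_pos)
    (fun n => by
      rw [hscalar]
      have h1 := hlin (n + 1)
      have h2 : c ≤ c * ((n + 1 : ℕ) : ℝ) := le_mul_of_one_le_right hc.le (by simp)
      have h3 := h2.trans h1
      gcongr)
    (fun n m => by
      have h := DegenerateSingular.mul_abs_sq_sub_sq_le_besselZero hc hgap (n + 1) (m + 1)
      rw [hscalar, hscalar, ← mul_sub, abs_mul, abs_of_nonneg (sq_nonneg κ), mul_assoc]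
      push_cast at h
      gcongr)
    (fun n => by
      have h := hB (n + 1)
      have h0 : 0 ≤ DegenerateSingular.besselZero (DegenerateSingular.nu α μ) (n + 1) :=
        (by positivity : 0 ≤ c * ((n + 1 : ℕ) : ℝ)).trans (hlin (n + 1))
      rw [hscalar, ← mul_pow, Real.sqrt_sq (by positivity), mul_assoc, ← mul_sub, abs_mul,
        abs_of_pos hκ0]
      push_cast at h
      gcongr)
    (DegenerateSingular.alphaTwo_sub_alphaOne_re_nonneg a₁ a₂)
    (fun n m hnm h => hspec (n + 1) (m + 1) (by omega) (by omega) (by omega)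
      (by linear_combination h))
  refine ⟨Λ, ?_, hyp⟩
  rw [hΛ, DegenerateSingular.setOf_exists_one_le_eq_range (fun n =>
      (DegenerateSingular.scalarEigenvalue α μ n : ℂ) + DegenerateSingular.alphaTwo a₁ a₂ -
        DegenerateSingular.alphaOne a₁ a₂),
    DegenerateSingular.setOf_exists_one_le_eq_range (fun n =>
      (DegenerateSingular.scalarEigenvalue α μ n : ℂ))]
  simp only [add_sub_assoc]
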